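/- Let $K$ be a field of characteristic $0$ that is complete with respect to a nontrivial non-archimedean absolute value. A power series is called locally analytic if its radius of convergence $\left(\limsup_n |a_n|^{1/n}\right)^{-1}$ is positive, and tangent to the identity if it has the form $x+O(x^2)$. Below, $h\circ f\circ h^{-1}$ is formed with series $h$ such that $h(0)=0$ and $h'(0)\neq 0$, and $h^{-1}$ is the compositional inverse. Two series over a field are formally equivalent over it if $h\circ f\circ h^{-1}=g$ for some such $h$, and analytically equivalent if $h$ can be taken locally analytic. (1) Let $f(x)=x+a_mx^m+O(x^{m+1})\in K[[x]]$ be locally analytic, with $m\ge 2$ and $a_m\ne 0$. Let $\alpha$ be a root of $\alpha^{m-1}=a_m$ in an extension field of $K$, and let $\widetilde K=K[\alpha]$ carry the absolute value extending that of $K$. Then there are $\mu\in\widetilde K$ and a locally analytic $h\in\widetilde K[[x]]$ tangent to the identity such that, with $L_\alpha(x)=\alpha x$, $$(h\circ L_\alpha)\circ f\circ (h\circ L_\alpha)^{-1}(x)=x+x^m+\mu x^{2m-1}.$$ In particular, if $a_m=1$ one may take $\alpha=1$ and $\widetilde K=K$, and then $h\circ f\circ h^{-1}(x)=x+x^m+\mu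 x^{2m-1}$. (2) The numbers $m$ and $\mu$ are analytic invariants: let $f=x+a_mx^m+O(x^{m+1})$ and $g=x+b_{m'}x^{m'}+O(x^{m'+1})$ be locally analytic over $K$, with $m,m'\ge2$ and $a_m,b_{m'}\neq0$, and let $L$ be a field extension of $K$ with an absolute value extending that of $K$. If $f$ and $g$ are analytically equivalent over $L$, then $m=m'$; and if moreover $f$ is analytically equivalent over $L$ to $x+x^m+\mu x^{2m-1}$ and $g$ to $x+x^{m'}+\mu' x^{2m'-1}$, where $\mu,\mu'\in L$, then $\mu=\mu'$. (With $f=g$: $\mu$ is determined by $f$.) (3) The formal and the analytic classification coincide: let $f,g\in K[[x]]$ be locally analytic and tangent to the identity, and let $c\in K$. There is a formal series $h\in K[[x]]$ with $h'(0)=c$ and $h\circ f\circ h^{-1}=g$ if and only if there is a locally analytic one. -/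

import Mathlib

open Filter
open scoped PowerSeries ENNReal IntermediateField

universe u v

namespace TangentToIdentity

/-- The radius of convergence about `0` of `∑ aₙ xⁿ`, namely `(limsup |aₙ|^(1/n))⁻¹`, computed in
`[0, ∞]`. -/
noncomputable def convergenceRadius {F : Type*} [NormedField F] (f : F⟦X⟧) : ℝ≥0∞ :=
  (limsup (fun n : ℕ => ‖PowerSeries.coeff n f‖ₑ ^ (1 / (n : ℝ))) atTop)⁻¹

/-- A power series is locally analytic at `0` if its radius of convergence is positive. -/
def LocallyAnalytic {F : Type*} [NormedField F] (f : F⟦X⟧) : Prop :=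
  0 < convergenceRadius f

/-- The composition `f ∘ g` of formal power series; it is only used for `g` without constant
term. -/
noncomputable def comp {F : Type*} [Field F] (f g : F⟦X⟧) : F⟦X⟧ :=
  PowerSeries.subst g f

/-- The series `x + O(x ^ 2)`. -/
def IsTangentToId {F : Type*} [Field F] (f : F⟦X⟧) : Prop :=
  PowerSeries.coeff 0 f = 0 ∧ PowerSeries.coeff 1 f = 1

/-- `f = x + a x ^ m + O(x ^ (m + 1))` with `2 ≤ m` and `a ≠ 0`. -/
def HasLeadingTerm {F : Type*} [Field F] (f : F⟦X⟧) (m : ℕ) (a : F) : Prop :=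
  IsTangentToId f ∧ 2 ≤ m ∧ (∀ n, 1 < n → n < m → PowerSeries.coeff n f = 0) ∧
    PowerSeries.coeff m f = a ∧ a ≠ 0

/-- The series `h` fixes the origin, is invertible under composition, and `h ∘ f ∘ h⁻¹ = g`; here
`k` is the compositional inverse `h⁻¹`. -/
def Conjugates {F : Type*} [Field F] (h f g : F⟦X⟧) : Prop :=
  PowerSeries.coeff 0 h = 0 ∧
    ∃ k : F⟦X⟧, PowerSeries.coeff 0 k = 0 ∧ comp h k = PowerSeries.X ∧
      comp k h = PowerSeries.X ∧ comp h (comp f k) = g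

/-- `f` and `g` are conjugate by a locally analytic germ fixing the origin. -/
def AnalyticallyEquivalent {F : Type*} [NormedField F] (f g : F⟦X⟧) : Prop :=
  ∃ h : F⟦X⟧, LocallyAnalytic h ∧ Conjugates h f g

/-- The linear map `x ↦ α x`. -/
noncomputable def dilation {F : Type*} [Field F] (α : F) : F⟦X⟧ :=
  PowerSeries.C α * PowerSeries.X

/-- The normal form `x + x ^ m + μ x ^ (2 m - 1)`, for `2 ≤ m`. -/
noncomputable def normalForm {F : Type*} [Field F] (m : ℕ) (μ : F) : F⟦X⟧ :=
  PowerSeries.X + PowerSeries.X ^ m + PowerSeries.C μ * PowerSeries.X ^ (2 * m - 1)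

end TangentToIdentity

/-!
Let `f` and `g` both have the form `x + a x ^ (d + 1) + ⋯`. Changing `h` by `b x ^ (n + 1)` changes
`h ∘ f - g ∘ h` by `(n - d) a b x ^ (n + d + 1)` to leading order, so in characteristic `0` the
coefficients of a conjugacy tangent to the identity can be solved for one after another, except at
the resonance `n = d`, where the coefficient of `x ^ (2 d + 1)` in `f - g` obstructs. This gives
the normal form and the invariance of `μ`.

Past the resonance the recursion divides successively by `a, 2 a, 3 a, …`. Rescale by a small
dilation so that `f`, `g` and the first coefficients of `h` are integral. The ultrametric inequality
then bounds the coefficients of `h` by `‖a ^ k k!‖⁻¹` with `k = n - (d + 1)`, and since `‖k!‖`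
decays at most geometrically, `h` converges. Hence, unless `f = x`, every formal conjugacy between
convergent series converges.
-/

namespace TangentToIdentity

open PowerSeries

section InitialTerm

variable {R : Type*} [CommRing R]

/-- `u = c xⁿ + O(xⁿ⁺¹)`. The coefficient `c` may vanish. -/
def HasInitialTerm (u : R⟦X⟧) (n : ℕ) (c : R) : Prop :=
  X ^ n ∣ u ∧ coeff n u = c

variable {u v : R⟦X⟧} {n k : ℕ} {b c : R}

lemma hasInitialTerm_iff_exists :
    HasInitialTerm u n c ↔ ∃ w, u = X ^ n * w ∧ constantCoeff w = c := by
  constructor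
  · rintro ⟨⟨w, rfl⟩, hc⟩
    exact ⟨w, rfl, by simpa [coeff_X_pow_mul'] using hc⟩
  · rintro ⟨w, rfl, hc⟩
    exact ⟨⟨w, rfl⟩, by simpa [coeff_X_pow_mul'] using hc⟩

lemma hasInitialTerm_constantCoeff (u : R⟦X⟧) : HasInitialTerm u 0 (constantCoeff u) :=
  ⟨by simp, by simp⟩

lemma hasInitialTerm_C_mul_X_pow (c : R) (n : ℕ) : HasInitialTerm (C c * X ^ n) n c :=
  hasInitialTerm_iff_exists.2 ⟨C c, mul_comm _ _, constantCoeff_C c⟩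

lemma hasInitialTerm_one_iff : HasInitialTerm u 1 c ↔ coeff 0 u = 0 ∧ coeff 1 u = c := by
  simp [HasInitialTerm, X_dvd_iff]

lemma hasInitialTerm_zero_iff : HasInitialTerm u n 0 ↔ X ^ (n + 1) ∣ u := by
  simp only [HasInitialTerm, X_pow_dvd_iff, Nat.lt_succ_iff_lt_or_eq, or_imp, forall_and,
    forall_eq]

namespace HasInitialTerm

lemma add (hu : HasInitialTerm u n b) (hv : HasInitialTerm v n c) :
    HasInitialTerm (u + v) n (b + c) :=
  ⟨dvd_add hu.1 hv.1, by rw [map_add, hu.2, hv.2]⟩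

lemma sub (hu : HasInitialTerm u n b) (hv : HasInitialTerm v n c) :
    HasInitialTerm (u - v) n (b - c) :=
  ⟨dvd_sub hu.1 hv.1, by rw [map_sub, hu.2, hv.2]⟩

lemma mul (hu : HasInitialTerm u n b) (hv : HasInitialTerm v k c) :
    HasInitialTerm (u * v) (n + k) (b * c) := by
  obtain ⟨w, rfl, rfl⟩ := hasInitialTerm_iff_exists.1 hu
  obtain ⟨z, rfl, rfl⟩ := hasInitialTerm_iff_exists.1 hv
  exact hasInitialTerm_iff_exists.2 ⟨w * z, by ring, map_mul _ _ _⟩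

lemma pow (hu : HasInitialTerm u n c) (k : ℕ) : HasInitialTerm (u ^ k) (n * k) (c ^ k) := by
  obtain ⟨w, rfl, rfl⟩ := hasInitialTerm_iff_exists.1 hu
  exact hasInitialTerm_iff_exists.2 ⟨w ^ k, by rw [mul_pow, pow_mul], map_pow _ _ _⟩

lemma sum {ι : Type*} {s : Finset ι} {u : ι → R⟦X⟧} {c : ι → R}
    (h : ∀ i ∈ s, HasInitialTerm (u i) n (c i)) :
    HasInitialTerm (∑ i ∈ s, u i) n (∑ i ∈ s, c i) :=
  ⟨Finset.dvd_sum fun i hi => (h i hi).1, by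
    rw [map_sum]; exact Finset.sum_congr rfl fun i hi => (h i hi).2⟩

lemma of_X_pow_dvd_sub (hu : HasInitialTerm u n c) (h : X ^ (n + 1) ∣ v - u) :
    HasInitialTerm v n c := by
  simpa using hu.add (hasInitialTerm_zero_iff.2 h)

lemma unique (hu : HasInitialTerm u n b) (hu' : HasInitialTerm u k c) (hb : b ≠ 0)
    (hc : c ≠ 0) : n = k ∧ b = c := by
  obtain rfl : n = k := by
    refine le_antisymm ?_ ?_ <;> by_contra! hlt
    · exact hc (hu'.2.symm.trans (X_pow_dvd_iff.1 hu.1 k hlt))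
    · exact hb (hu.2.symm.trans (X_pow_dvd_iff.1 hu'.1 n hlt))
  exact ⟨rfl, hu.2.symm.trans hu'.2⟩

lemma pow_succ_sub_pow_succ {e : R} (hu : HasInitialTerm u 1 e) (hv : HasInitialTerm v 1 e)
    (huv : HasInitialTerm (u - v) n b) (k : ℕ) :
    HasInitialTerm (u ^ (k + 1) - v ^ (k + 1)) (n + k) ((k + 1) * e ^ k * b) := by
  have key : HasInitialTerm (∑ i ∈ Finset.range (k + 1), u ^ i * v ^ (k - i)) k
      (∑ _i ∈ Finset.range (k + 1), e ^ k) := by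
    refine sum fun i hi => ?_
    have hik : i + (k - i) = k := by have := Finset.mem_range.1 hi; omega
    simpa [← pow_add, hik] using (hu.pow i).mul (hv.pow (k - i))
  have := key.mul huv
  rw [← (Commute.all u v).geom_sum₂_mul]
  simpa [add_comm k n] using this

end HasInitialTerm

end InitialTerm

section Composition

variable {F : Type*} [Field F]

lemma hasSubst_of_coeff_zero {g : F⟦X⟧} (hg : coeff 0 g = 0) : HasSubst g :=
  HasSubst.of_constantCoeff_zero' (by simpa using hg)

lemma coeff_comp {g : F⟦X⟧} (hg : coeff 0 g = 0) (f : F⟦X⟧) (n : ℕ) :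
    coeff n (comp f g) = ∑ k ∈ Finset.range (n + 1), coeff k f * coeff n (g ^ k) := by
  rw [comp, coeff_subst' (hasSubst_of_coeff_zero hg)]
  refine finsum_eq_sum_of_support_subset _ fun k hk => ?_
  have hgk : X ^ k ∣ g ^ k := pow_dvd_pow_of_dvd (X_dvd_iff.2 (by simpa using hg)) k
  contrapose! hk
  have hnk : n < k := by simpa [Nat.lt_succ_iff] using hk
  simp [X_pow_dvd_iff.1 hgk n hnk]

lemma coeff_zero_comp {f g : F⟦X⟧} (hg : coeff 0 g = 0) : coeff 0 (comp f g) = coeff 0 f := by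
  simp [coeff_comp hg]

lemma comp_assoc {f g h : F⟦X⟧} (hg : coeff 0 g = 0) (hh : coeff 0 h = 0) :
    comp (comp f g) h = comp f (comp g h) :=
  subst_comp_subst_apply (hasSubst_of_coeff_zero hg) (hasSubst_of_coeff_zero hh) f

lemma comp_X (f : F⟦X⟧) : comp f X = f := X_subst f

lemma X_comp {g : F⟦X⟧} (hg : coeff 0 g = 0) : comp X g = g :=
  subst_X (hasSubst_of_coeff_zero hg)

lemma C_comp (c : F) (g : F⟦X⟧) : comp (C c) g = C c := subst_C c

lemma comp_add {g : F⟦X⟧} (hg : coeff 0 g = 0) (a b : F⟦X⟧) :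
    comp (a + b) g = comp a g + comp b g := subst_add (hasSubst_of_coeff_zero hg) a b

lemma comp_sub {g : F⟦X⟧} (hg : coeff 0 g = 0) (a b : F⟦X⟧) :
    comp (a - b) g = comp a g - comp b g := subst_sub (hasSubst_of_coeff_zero hg) a b

lemma comp_mul {g : F⟦X⟧} (hg : coeff 0 g = 0) (a b : F⟦X⟧) :
    comp (a * b) g = comp a g * comp b g := subst_mul (hasSubst_of_coeff_zero hg) a b

lemma X_pow_mul_comp {g : F⟦X⟧} (hg : coeff 0 g = 0) (n : ℕ) (a : F⟦X⟧) :
    comp (X ^ n * a) g = g ^ n * comp a g := by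
  rw [comp_mul hg, comp, subst_pow (hasSubst_of_coeff_zero hg),
    subst_X (hasSubst_of_coeff_zero hg)]

lemma X_pow_dvd_comp_sub_comp {g h : F⟦X⟧} (hg : coeff 0 g = 0) (hh : coeff 0 h = 0) {n : ℕ}
    (H : X ^ n ∣ g - h) (f : F⟦X⟧) : X ^ n ∣ comp f g - comp f h := by
  rw [X_pow_dvd_iff]
  intro j hj
  rw [map_sub, coeff_comp hg, coeff_comp hh, ← Finset.sum_sub_distrib]
  refine Finset.sum_eq_zero fun k _ => ?_
  rw [← mul_sub, ← map_sub, X_pow_dvd_iff.1 (H.trans (sub_dvd_pow_sub_pow g h k)) j hj, mul_zero]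

namespace HasInitialTerm

variable {u v φ : F⟦X⟧} {n k : ℕ} {b c e : F}

lemma coeff_zero (hu : HasInitialTerm u 1 e) : coeff 0 u = 0 :=
  (hasInitialTerm_one_iff.1 hu).1

protected lemma comp (hφ : HasInitialTerm φ k c) (hu : HasInitialTerm u 1 e) :
    HasInitialTerm (comp φ u) k (e ^ k * c) := by
  obtain ⟨ε, rfl, rfl⟩ := hasInitialTerm_iff_exists.1 hφ
  have hε : constantCoeff (comp ε u) = constantCoeff ε := by
    simpa using coeff_zero_comp (f := ε) hu.coeff_zero
  rw [X_pow_mul_comp hu.coeff_zero, ← hε]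
  simpa using (hu.pow k).mul (hasInitialTerm_constantCoeff (comp ε u))

/-- The first order Taylor formula `φ(v + w) = φ(v) + φ'(v) w + O(w²)`, for leading terms. -/
lemma comp_sub_comp (hφ : HasInitialTerm φ (k + 1) c) (hu : HasInitialTerm u 1 e)
    (hv : HasInitialTerm v 1 e) (huv : HasInitialTerm (u - v) n b) :
    HasInitialTerm (comp φ u - comp φ v) (n + k) ((k + 1) * e ^ k * b * c) := by
  have hu0 := hu.coeff_zero
  have hv0 := hv.coeff_zero
  obtain ⟨ε, rfl, rfl⟩ := hasInitialTerm_iff_exists.1 hφ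
  have hε : HasInitialTerm (comp ε u) 0 (constantCoeff ε) := by
    simpa using (hasInitialTerm_constantCoeff ε).comp hu
  have hε' : X ^ (n + k + 1) ∣ v ^ (k + 1) * (comp ε u - comp ε v) := by
    rw [add_assoc, add_comm, pow_add]
    refine mul_dvd_mul ?_ (X_pow_dvd_comp_sub_comp hu0 hv0 huv.1 ε)
    simpa using (hv.pow (k + 1)).1
  refine ((hu.pow_succ_sub_pow_succ hv huv k).mul hε).of_X_pow_dvd_sub ?_
  rw [X_pow_mul_comp hu0, X_pow_mul_comp hv0]
  convert hε' using 1
  ring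

end HasInitialTerm

end Composition

section LeadingTerm

variable {F : Type*} [Field F] {f g h : F⟦X⟧}

lemma isTangentToId_iff : IsTangentToId f ↔ HasInitialTerm f 1 1 :=
  hasInitialTerm_one_iff.symm

lemma isTangentToId_X : IsTangentToId (X : F⟦X⟧) := by simp [IsTangentToId]

lemma IsTangentToId.of_X_sq_dvd_sub (hf : IsTangentToId f) (h : X ^ 2 ∣ g - f) :
    IsTangentToId g :=
  isTangentToId_iff.2 ((isTangentToId_iff.1 hf).of_X_pow_dvd_sub h)

lemma hasLeadingTerm_iff {m : ℕ} {a : F} :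
    HasLeadingTerm f m a ↔ 2 ≤ m ∧ a ≠ 0 ∧ HasInitialTerm (f - X) m a := by
  have hX (n : ℕ) (hn : 1 < n) : coeff n (f - X) = coeff n f := by
    rw [map_sub, coeff_X, if_neg hn.ne', sub_zero]
  constructor
  · rintro ⟨⟨h0, h1⟩, hm, hz, ha, ha0⟩
    refine ⟨hm, ha0, X_pow_dvd_iff.2 fun n hn => ?_, by rw [hX m hm, ha]⟩
    match n with
    | 0 => simp only [map_sub, h0, coeff_zero_X, sub_zero]
    | 1 => rw [map_sub, h1, coeff_one_X, sub_self]
    | n + 2 => rw [hX _ (by omega), hz _ (by omega) hn]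
  · rintro ⟨hm, ha0, hdvd, ha⟩
    refine ⟨isTangentToId_X.of_X_sq_dvd_sub ((pow_dvd_pow X hm).trans hdvd), hm,
      fun n hn hnm => ?_, by rw [← hX m hm, ha], ha0⟩
    rw [← hX n hn, X_pow_dvd_iff.1 hdvd n hnm]

lemma IsTangentToId.exists_hasLeadingTerm (hf : IsTangentToId f) (hX : f ≠ X) :
    ∃ m a, HasLeadingTerm f m a := by
  classical
  have hex : ∃ n, 1 < n ∧ coeff n f ≠ 0 := by
    by_contra! H
    refine hX (ext fun n => ?_)
    match n with
    | 0 => rw [hf.1, coeff_zero_X]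
    | 1 => rw [hf.2, coeff_one_X]
    | n + 2 => rw [H _ (by omega), coeff_X, if_neg (by omega)]
  obtain ⟨hlt, hne⟩ := Nat.find_spec hex
  exact ⟨Nat.find hex, _, hf, hlt,
    fun n hn hlt => by_contra fun hn0 => Nat.find_min hex hlt ⟨hn, hn0⟩, rfl, hne⟩

lemma HasLeadingTerm.map {m : ℕ} {a : F} (hf : HasLeadingTerm f m a) {E : Type*} [Field E]
    (φ : F →+* E) : HasLeadingTerm (PowerSeries.map φ f) m (φ a) := by
  obtain ⟨⟨h0, h1⟩, hm, hz, ha, ha0⟩ := hf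
  refine ⟨⟨?_, ?_⟩, hm, fun n hn hnm => ?_, ?_, (map_ne_zero φ).2 ha0⟩
  · rw [coeff_map, h0, map_zero]
  · rw [coeff_map, h1, map_one]
  · rw [coeff_map, hz n hn hnm, map_zero]
  · rw [coeff_map, ha]

lemma normalForm_succ (d : ℕ) (μ : F) :
    normalForm (d + 1) μ = X + X ^ (d + 1) + C μ * X ^ (2 * d + 1) := rfl

lemma hasLeadingTerm_normalForm {m : ℕ} (hm : 2 ≤ m) (μ : F) :
    HasLeadingTerm (normalForm m μ) m 1 := by
  refine hasLeadingTerm_iff.2 ⟨hm, one_ne_zero, ?_⟩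
  have hX : HasInitialTerm (X ^ m : F⟦X⟧) m 1 := by simpa using hasInitialTerm_C_mul_X_pow (1 : F) m
  refine hX.of_X_pow_dvd_sub ?_
  rw [normalForm, add_assoc, add_sub_cancel_left, add_sub_cancel_left]
  exact Dvd.dvd.mul_left (pow_dvd_pow X (by omega)) _

lemma HasLeadingTerm.eq_of_comp_eq {m m' : ℕ} {a a' c : F} (hf : HasLeadingTerm f m a)
    (hg : HasLeadingTerm g m' a') (hh : HasInitialTerm h 1 c) (hc : c ≠ 0)
    (H : comp h f = comp g h) : m = m' ∧ a * c = c ^ m * a' := by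
  obtain ⟨-, ha, hfX⟩ := hasLeadingTerm_iff.1 hf
  obtain ⟨-, ha', hgX⟩ := hasLeadingTerm_iff.1 hg
  have hleft : HasInitialTerm (comp h f - comp h X) m (a * c) := by
    simpa using hh.comp_sub_comp (k := 0) (isTangentToId_iff.1 hf.1)
      (isTangentToId_iff.1 isTangentToId_X) hfX
  have hright : HasInitialTerm (comp h f - comp h X) m' (c ^ m' * a') := by
    convert hgX.comp hh using 1
    rw [H, comp_X, comp_sub hh.coeff_zero, X_comp hh.coeff_zero]
  obtain ⟨rfl, hac⟩ :=
    hleft.unique hright (mul_ne_zero ha hc) (mul_ne_zero (pow_ne_zero _ hc) ha')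
  exact ⟨rfl, hac⟩

end LeadingTerm

section Defect

variable {F : Type*} [Field F] {f g h h' : F⟦X⟧} {d n : ℕ} {a b : F}

/-- The failure `h ∘ f - g ∘ h` of `h` to conjugate `f` to `g`. -/
noncomputable def defect (f g h : F⟦X⟧) : F⟦X⟧ :=
  comp h f - comp g h

lemma defect_eq_zero_iff : defect f g h = 0 ↔ comp h f = comp g h := sub_eq_zero

lemma defect_X (f0 : coeff 0 f = 0) : defect f g X = f - g := by
  rw [defect, X_comp f0, comp_X]

lemma X_pow_dvd_defect_sub_defect (hf : IsTangentToId f) (h0 : coeff 0 h = 0)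
    (h0' : coeff 0 h' = 0) (H : X ^ n ∣ h - h') : X ^ n ∣ defect f g h - defect f g h' := by
  have hcomp : X ^ n ∣ comp (h - h') f :=
    (HasInitialTerm.comp ⟨H, rfl⟩ (isTangentToId_iff.1 hf)).1
  rw [defect, defect, sub_sub_sub_comm, ← comp_sub hf.1]
  exact dvd_sub hcomp (X_pow_dvd_comp_sub_comp h0 h0' H g)

/-- The linearised conjugacy equation. The resonance at `n = d` is the reason for the parameter of
the normal form. -/
lemma HasLeadingTerm.defect_sub_defect (hf : HasLeadingTerm f (d + 1) a)
    (hg : HasLeadingTerm g (d + 1) a) (hh : IsTangentToId h) (hh' : IsTangentToId h')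
    (H : HasInitialTerm (h - h') (n + 1) b) :
    HasInitialTerm (defect f g h - defect f g h') (n + d + 1) ((n - d) * a * b) := by
  have hleft : HasInitialTerm (comp (h - h') f - comp (h - h') X) (n + d + 1)
      ((n + 1) * a * b) := by
    convert H.comp_sub_comp (isTangentToId_iff.1 hf.1) (isTangentToId_iff.1 isTangentToId_X)
      (hasLeadingTerm_iff.1 hf).2.2 using 1
    · ring
    · ring
  have hright : HasInitialTerm (comp (g - X) h - comp (g - X) h') (n + d + 1)
      ((d + 1) * b * a) := by
    convert (hasLeadingTerm_iff.1 hg).2.2.comp_sub_comp (isTangentToId_iff.1 hh)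
      (isTangentToId_iff.1 hh') H using 1
    · ring
    · ring
  convert hleft.sub hright using 1
  · rw [comp_X, comp_sub hf.1.1, comp_sub hh.1, comp_sub hh'.1, X_comp hh.1, X_comp hh'.1, defect,
      defect]
    ring
  · ring

end Defect

section FormalClassification

variable {F : Type*} [Field F] {f g h : F⟦X⟧} {d n : ℕ} {a : F}

lemma HasLeadingTerm.exists_X_pow_succ_dvd_defect [CharZero F] (hf : HasLeadingTerm f (d + 1) a)
    (hg : HasLeadingTerm g (d + 1) a) (hn : 1 ≤ n) (hnd : n ≠ d) (hh : IsTangentToId h)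
    (H : X ^ (n + d + 1) ∣ defect f g h) :
    ∃ h', IsTangentToId h' ∧ X ^ (n + 1) ∣ h' - h ∧ X ^ (n + d + 2) ∣ defect f g h' := by
  have hnz : ((n : F) - d) * a ≠ 0 :=
    mul_ne_zero (sub_ne_zero.2 (Nat.cast_injective.ne hnd)) (hasLeadingTerm_iff.1 hf).2.1
  set e := coeff (n + d + 1) (defect f g h)
  set b := -e / ((n - d) * a)
  have hb : HasInitialTerm (h + C b * X ^ (n + 1) - h) (n + 1) b := by
    simpa using hasInitialTerm_C_mul_X_pow b (n + 1)
  have hh' : IsTangentToId (h + C b * X ^ (n + 1)) :=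
    hh.of_X_sq_dvd_sub ((pow_dvd_pow X (by omega)).trans hb.1)
  refine ⟨_, hh', hb.1, hasInitialTerm_zero_iff.1 ?_⟩
  have := (hf.defect_sub_defect hg hh' hh hb).add ⟨H, rfl⟩
  rwa [sub_add_cancel, mul_div_cancel₀ _ hnz, neg_add_cancel] at this

lemma HasLeadingTerm.exists_X_pow_dvd_defect [CharZero F] (hf : HasLeadingTerm f (d + 1) a)
    (hg : HasLeadingTerm g (d + 1) a) :
    ∃ h, IsTangentToId h ∧ X ^ (2 * d + 1) ∣ defect f g h := by
  have approx (n : ℕ) (hn : 1 ≤ n) :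
      n ≤ d → ∃ h, IsTangentToId h ∧ X ^ (n + d + 1) ∣ defect f g h := by
    induction n, hn using Nat.le_induction with
    | base =>
      refine fun _ => ⟨X, isTangentToId_X, ?_⟩
      have := (hasLeadingTerm_iff.1 hf).2.2.sub (hasLeadingTerm_iff.1 hg).2.2
      rw [sub_sub_sub_cancel_right, sub_self, hasInitialTerm_zero_iff] at this
      rwa [defect_X hf.1.1, add_comm 1 d]
    | succ n hn ih =>
      intro hnd
      obtain ⟨h, hh, hdvd⟩ := ih (by omega)
      obtain ⟨h', hh', -, hdvd'⟩ := hf.exists_X_pow_succ_dvd_defect hg hn (by omega) hh hdvd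
      exact ⟨h', hh', by rwa [add_right_comm n 1 d]⟩
  have hd : 1 ≤ d := by have := hf.2.1; omega
  simpa only [two_mul] using approx d hd le_rfl

lemma exists_limit_of_approximations {R : Type*} [CommRing R] {P : ℕ → R⟦X⟧ → Prop} {h₀ : R⟦X⟧}
    (zero : P 0 h₀) (succ : ∀ k h, P k h → ∃ h', P (k + 1) h' ∧ X ^ k ∣ h' - h) :
    ∃ h, ∀ k, ∃ h', P k h' ∧ X ^ k ∣ h - h' := by
  choose! next hnext hdvd using succ
  let s : ℕ → R⟦X⟧ := Nat.rec h₀ next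
  have hs (k : ℕ) : P k (s k) := by
    induction k with
    | zero => exact zero
    | succ k ih => exact hnext k _ ih
  have hs_dvd {k l : ℕ} (hkl : k ≤ l) : X ^ k ∣ s l - s k := by
    induction l, hkl using Nat.le_induction with
    | base => simp
    | succ l hkl ih =>
      rw [← sub_add_sub_cancel]
      exact dvd_add ((pow_dvd_pow X hkl).trans (hdvd l _ (hs l))) ih
  refine ⟨mk fun n => coeff n (s (n + 1)), fun k => ⟨s k, hs k, X_pow_dvd_iff.2 fun j hj => ?_⟩⟩
  have := X_pow_dvd_iff.1 (hs_dvd (Nat.succ_le_of_lt hj)) j (Nat.lt_succ_self j)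
  rw [map_sub, coeff_mk, ← neg_sub, ← map_sub, this, neg_zero]

lemma HasLeadingTerm.exists_comp_eq_of_X_pow_dvd_defect [CharZero F]
    (hf : HasLeadingTerm f (d + 1) a) (hg : HasLeadingTerm g (d + 1) a) (hh : IsTangentToId h)
    (H : X ^ (2 * d + 2) ∣ defect f g h) :
    ∃ h, IsTangentToId h ∧ comp h f = comp g h := by
  obtain ⟨h', happrox⟩ := exists_limit_of_approximations
    (P := fun k h => IsTangentToId h ∧ X ^ (d + 1 + k + d + 1) ∣ defect f g h) (h₀ := h)
    ⟨hh, by rwa [show d + 1 + 0 + d + 1 = 2 * d + 2 by ring]⟩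
    (by
      rintro k h ⟨hh, hdvd⟩
      obtain ⟨h', hh', hsub, hdvd'⟩ :=
        hf.exists_X_pow_succ_dvd_defect hg (by omega) (by omega) hh hdvd
      exact ⟨h', ⟨hh', by convert hdvd' using 2; ring⟩, (pow_dvd_pow X (by omega)).trans hsub⟩)
  obtain ⟨h₂, ⟨hh₂, -⟩, hsub₂⟩ := happrox 2
  have hh' : IsTangentToId h' := hh₂.of_X_sq_dvd_sub hsub₂
  refine ⟨h', hh', defect_eq_zero_iff.1 (ext fun n => ?_)⟩
  obtain ⟨hₙ, ⟨hhₙ, hdvdₙ⟩, hsubₙ⟩ := happrox (n + 1)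
  have hdvd : X ^ (n + 1) ∣ defect f g h' := by
    rw [← sub_add_cancel (defect f g h') (defect f g hₙ)]
    exact dvd_add (X_pow_dvd_defect_sub_defect hf.1 hh'.1 hhₙ.1 hsubₙ)
      ((pow_dvd_pow X (by omega)).trans hdvdₙ)
  rw [X_pow_dvd_iff.1 hdvd n n.lt_succ_self, map_zero]

lemma HasLeadingTerm.exists_comp_eq_normalForm [CharZero F] (hf : HasLeadingTerm f (d + 1) 1) :
    ∃ μ h, IsTangentToId h ∧ comp h f = comp (normalForm (d + 1) μ) h := by
  obtain ⟨h, hh, hdvd⟩ := hf.exists_X_pow_dvd_defect (hasLeadingTerm_normalForm hf.2.1 0)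
  set μ := coeff (2 * d + 1) (defect f (normalForm (d + 1) 0) h)
  have h₀μ : HasInitialTerm (defect f (normalForm (d + 1) 0) h) (2 * d + 1) μ := ⟨hdvd, rfl⟩
  have hμ : HasInitialTerm (comp (C μ * X ^ (2 * d + 1)) h) (2 * d + 1) μ := by
    simpa using (hasInitialTerm_C_mul_X_pow μ (2 * d + 1)).comp (isTangentToId_iff.1 hh)
  have hdefect : defect f (normalForm (d + 1) μ) h =
      defect f (normalForm (d + 1) 0) h - comp (C μ * X ^ (2 * d + 1)) h := by
    rw [defect, defect, sub_sub, ← comp_add hh.1, normalForm_succ, normalForm_succ, map_zero,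
      zero_mul, add_zero]
  refine ⟨μ, hf.exists_comp_eq_of_X_pow_dvd_defect (hasLeadingTerm_normalForm hf.2.1 μ) hh ?_⟩
  rw [hdefect, ← hasInitialTerm_zero_iff]
  simpa only [sub_self] using h₀μ.sub hμ

lemma HasLeadingTerm.coeff_eq_of_comp_eq [CharZero F] (hf : HasLeadingTerm f (d + 1) a)
    (hg : HasLeadingTerm g (d + 1) a) (hfg : X ^ (2 * d + 1) ∣ f - g) (hh : IsTangentToId h)
    (H : comp h f = comp g h) : coeff (2 * d + 1) f = coeff (2 * d + 1) g := by
  have hd : 1 ≤ d := by have := hf.2.1; omega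
  have hcoeff {n : ℕ} (hdvd : X ^ (n + 1) ∣ h - X) :
      -coeff (n + d + 1) (f - g) = (n - d) * a * coeff (n + 1) (h - X) := by
    have := (hf.defect_sub_defect hg hh isTangentToId_X ⟨hdvd, rfl⟩).2
    rwa [defect_eq_zero_iff.2 H, defect_X hf.1.1, zero_sub, map_neg] at this
  have hdvd (n : ℕ) (hn : 1 ≤ n) : n ≤ d → X ^ (n + 1) ∣ h - X := by
    induction n, hn using Nat.le_induction with
    | base =>
      have := (isTangentToId_iff.1 hh).sub (isTangentToId_iff.1 isTangentToId_X)
      rw [sub_self, hasInitialTerm_zero_iff] at this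
      exact fun _ => this
    | succ n _ ih =>
      intro hnd
      have hnz : ((n : F) - d) * a ≠ 0 :=
        mul_ne_zero (sub_ne_zero.2 (Nat.cast_injective.ne (by omega))) (hasLeadingTerm_iff.1 hf).2.1
      have hcoeffₙ := hcoeff (ih (by omega))
      rw [X_pow_dvd_iff.1 hfg _ (by omega), neg_zero, zero_eq_mul] at hcoeffₙ
      exact hasInitialTerm_zero_iff.1 ⟨ih (by omega), hcoeffₙ.resolve_left hnz⟩
  have hres := hcoeff (hdvd d hd le_rfl)
  rwa [sub_self, zero_mul, zero_mul, neg_eq_zero, map_sub, sub_eq_zero, ← two_mul] at hres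

end FormalClassification

section Conjugation

variable {F : Type*} [Field F] {e f g h h' : F⟦X⟧}

lemma conjugates_iff (f0 : coeff 0 f = 0) :
    Conjugates h f g ↔ ∃ c ≠ 0, HasInitialTerm h 1 c ∧ comp h f = comp g h := by
  constructor
  · rintro ⟨h0, k, k0, hk, hk', rfl⟩
    have hhk := (hasInitialTerm_one_iff.2 ⟨h0, rfl⟩).comp (hasInitialTerm_one_iff.2 ⟨k0, rfl⟩)
    have h1 : (1 : F) = coeff 1 k ^ 1 * coeff 1 h := by rw [← hhk.2, hk, coeff_one_X]
    refine ⟨coeff 1 h, right_ne_zero_of_mul (h1 ▸ one_ne_zero),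
      hasInitialTerm_one_iff.2 ⟨h0, rfl⟩, ?_⟩
    have fk0 : coeff 0 (comp f k) = 0 := by rw [coeff_zero_comp k0, f0]
    rw [comp_assoc fk0 h0, comp_assoc k0 h0, hk', comp_X]
  · rintro ⟨c, hc, hh, H⟩
    have hu : IsUnit (coeff 1 h) := isUnit_iff_ne_zero.2 (hh.2 ▸ hc)
    have h0 : constantCoeff h = 0 := by simpa using hh.coeff_zero
    have k0 : coeff 0 (substInvOfIsUnit h hu) = 0 := by simp
    have hk : comp h (substInvOfIsUnit h hu) = X := subst_substInvOfIsUnit_right h h0 hu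
    refine ⟨hh.coeff_zero, substInvOfIsUnit h hu, k0, hk,
      subst_substInvOfIsUnit_left h h0 hu, ?_⟩
    rw [← comp_assoc f0 k0, H, comp_assoc hh.coeff_zero k0, hk, comp_X]

lemma Conjugates.trans (f0 : coeff 0 f = 0) (g0 : coeff 0 g = 0) (H : Conjugates h f g)
    (H' : Conjugates h' g e) : Conjugates (comp h' h) f e := by
  obtain ⟨c, hc, hh, hfg⟩ := (conjugates_iff f0).1 H
  obtain ⟨c', hc', hh', hge⟩ := (conjugates_iff g0).1 H'
  refine (conjugates_iff f0).2 ⟨_, mul_ne_zero (pow_ne_zero 1 hc) hc', hh'.comp hh, ?_⟩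
  rw [comp_assoc hh.coeff_zero f0, hfg, ← comp_assoc g0 hh.coeff_zero, hge,
    comp_assoc hh'.coeff_zero hh.coeff_zero]

/-- Conjugacy by a formal series fixing the origin, convergent or not. -/
def FormallyEquivalent (f g : F⟦X⟧) : Prop :=
  ∃ h, Conjugates h f g

namespace FormallyEquivalent

lemma symm (f0 : coeff 0 f = 0) (H : FormallyEquivalent f g) : FormallyEquivalent g f := by
  obtain ⟨h, H⟩ := H
  obtain ⟨-, -, -, hfg⟩ := (conjugates_iff f0).1 H
  obtain ⟨h0, k, k0, hk, hk', -⟩ := H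
  exact ⟨k, k0, h, h0, hk', hk, by rw [← hfg, ← comp_assoc h0 f0, hk', X_comp f0]⟩

lemma trans (f0 : coeff 0 f = 0) (g0 : coeff 0 g = 0) (H : FormallyEquivalent f g)
    (H' : FormallyEquivalent g e) : FormallyEquivalent f e :=
  let ⟨_, hH⟩ := H
  let ⟨_, hH'⟩ := H'
  ⟨_, hH.trans f0 g0 hH'⟩

lemma order_eq {m m' : ℕ} {a a' : F} (H : FormallyEquivalent f g) (hf : HasLeadingTerm f m a)
    (hg : HasLeadingTerm g m' a') : m = m' :=
  let ⟨_, hH⟩ := H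
  let ⟨_, hc, hh, hfg⟩ := (conjugates_iff hf.1.1).1 hH
  (hf.eq_of_comp_eq hg hh hc hfg).1

end FormallyEquivalent

lemma AnalyticallyEquivalent.formallyEquivalent {F : Type*} [NormedField F] {f g : F⟦X⟧}
    (H : AnalyticallyEquivalent f g) : FormallyEquivalent f g :=
  let ⟨h, _, hH⟩ := H
  ⟨h, hH⟩

lemma Conjugates.eq_X_iff (f0 : coeff 0 f = 0) (H : Conjugates h f g) : f = X ↔ g = X := by
  obtain ⟨h0, k, k0, hk, hk', hg⟩ := H
  have hfk : comp f k = comp k g := by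
    have fk0 : coeff 0 (comp f k) = 0 := by rw [coeff_zero_comp k0, f0]
    rw [← hg, ← comp_assoc h0 fk0, hk', X_comp fk0]
  constructor
  · rintro rfl
    rw [← hg, X_comp k0, hk]
  · rintro rfl
    rw [← comp_X f, ← hk', ← comp_assoc k0 h0, hfk, comp_X]

end Conjugation

section Rescaling

variable {F : Type*} [Field F] {f g h : F⟦X⟧} {t : F}

lemma coeff_zero_dilation (t : F) : coeff 0 (dilation t) = 0 := by simp [dilation]

lemma dilation_comp (f0 : coeff 0 f = 0) (t : F) : comp (dilation t) f = C t * f := by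
  rw [dilation, comp_mul f0, C_comp, X_comp f0]

lemma coeff_comp_dilation (f : F⟦X⟧) (t : F) (n : ℕ) :
    coeff n (comp f (dilation t)) = t ^ n * coeff n f := by
  rw [comp, dilation, ← smul_eq_C_mul, ← rescale_eq_subst, coeff_rescale]

lemma dilation_comp_dilation (s t : F) : comp (dilation s) (dilation t) = dilation (s * t) := by
  rw [dilation_comp (coeff_zero_dilation t), dilation, dilation, map_mul, mul_assoc]

lemma dilation_one : dilation (1 : F) = X := by simp [dilation]

/-- The conjugate `f(t x) / t` of `f` by a dilation. -/
noncomputable def rescaling (t : F) (f : F⟦X⟧) : F⟦X⟧ :=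
  comp (dilation t⁻¹) (comp f (dilation t))

lemma coeff_zero_rescaling (f0 : coeff 0 f = 0) (t : F) : coeff 0 (rescaling t f) = 0 := by
  have ft0 : coeff 0 (comp f (dilation t)) = 0 := by rw [coeff_comp_dilation, f0, mul_zero]
  rw [rescaling, coeff_zero_comp ft0, coeff_zero_dilation]

lemma coeff_succ_rescaling (f0 : coeff 0 f = 0) (ht : t ≠ 0) (n : ℕ) :
    coeff (n + 1) (rescaling t f) = t ^ n * coeff (n + 1) f := by
  have ft0 : coeff 0 (comp f (dilation t)) = 0 := by rw [coeff_comp_dilation, f0, mul_zero]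
  rw [rescaling, dilation_comp ft0, coeff_C_mul, coeff_comp_dilation, pow_succ', ← mul_assoc,
    inv_mul_cancel_left₀ ht]

lemma conjugates_rescaling (f : F⟦X⟧) (ht : t ≠ 0) :
    Conjugates (dilation t⁻¹) f (rescaling t f) :=
  ⟨coeff_zero_dilation _, dilation t, coeff_zero_dilation _,
    by rw [dilation_comp_dilation, inv_mul_cancel₀ ht, dilation_one],
    by rw [dilation_comp_dilation, mul_inv_cancel₀ ht, dilation_one], rfl⟩

lemma rescaling_comp_rescaling (f0 : coeff 0 f = 0) (g0 : coeff 0 g = 0) (ht : t ≠ 0) :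
    comp (rescaling t f) (rescaling t g) = rescaling t (comp f g) := by
  have t0 := coeff_zero_dilation t
  have gt0 : coeff 0 (comp g (dilation t)) = 0 := by rw [coeff_zero_comp t0, g0]
  have ft0 : coeff 0 (comp f (dilation t)) = 0 := by rw [coeff_zero_comp t0, f0]
  have hg : comp (dilation t) (rescaling t g) = comp g (dilation t) := by
    rw [rescaling, ← comp_assoc (coeff_zero_dilation _) gt0, dilation_comp_dilation,
      mul_inv_cancel₀ ht, dilation_one, X_comp gt0]
  have gr0 := coeff_zero_rescaling g0 t
  rw [rescaling, comp_assoc ft0 gr0, comp_assoc t0 gr0, hg, ← comp_assoc g0 t0, rescaling]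

lemma rescaling_inv_rescaling (f0 : coeff 0 f = 0) (ht : t ≠ 0) :
    rescaling t⁻¹ (rescaling t f) = f := by
  have ft0 := coeff_zero_rescaling f0 t
  ext n
  rcases n with _ | n
  · rw [coeff_zero_rescaling ft0, f0]
  · rw [coeff_succ_rescaling ft0 (inv_ne_zero ht), coeff_succ_rescaling f0 ht, ← mul_assoc,
      ← mul_pow, inv_mul_cancel₀ ht, one_pow, one_mul]

protected lemma IsTangentToId.rescaling (hf : IsTangentToId f) (ht : t ≠ 0) :
    IsTangentToId (rescaling t f) :=
  ⟨coeff_zero_rescaling hf.1 t, by rw [coeff_succ_rescaling hf.1 ht, pow_zero, one_mul, hf.2]⟩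

protected lemma HasLeadingTerm.rescaling {d : ℕ} {a : F} (hf : HasLeadingTerm f (d + 1) a)
    (ht : t ≠ 0) : HasLeadingTerm (rescaling t f) (d + 1) (t ^ d * a) := by
  obtain ⟨hf, hd, hz, ha, ha0⟩ := hf
  refine ⟨hf.rescaling ht, hd, fun n hn hnd => ?_, ?_, mul_ne_zero (pow_ne_zero d ht) ha0⟩
  · obtain ⟨n, rfl⟩ : ∃ k, n = k + 1 := ⟨n - 1, by omega⟩
    rw [coeff_succ_rescaling hf.1 ht, hz _ hn hnd, mul_zero]
  · rw [coeff_succ_rescaling hf.1 ht, ha]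

lemma rescaling_normalForm {d : ℕ} (ht : t ^ d = 1) (hd : d ≠ 0) (μ : F) :
    rescaling t (normalForm (d + 1) μ) = normalForm (d + 1) μ := by
  have ht0 : t ≠ 0 := by rintro rfl; simp [hd] at ht
  have h0 := (hasLeadingTerm_normalForm (by omega : 2 ≤ d + 1) μ).1.1
  ext n
  rcases n with _ | n
  · rw [coeff_zero_rescaling h0, h0]
  rw [coeff_succ_rescaling h0 ht0, normalForm_succ]
  simp only [map_add, coeff_C_mul, coeff_X, coeff_X_pow, add_left_inj, Nat.add_eq_right]
  by_cases hdvd : d ∣ n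
  · obtain ⟨k, rfl⟩ := hdvd
    rw [pow_mul, ht, one_pow, one_mul]
  · have h0n : n ≠ 0 := by rintro rfl; exact hdvd (dvd_zero d)
    have hdn : n ≠ d := by rintro rfl; exact hdvd dvd_rfl
    have h2dn : n ≠ 2 * d := by rintro rfl; exact hdvd (dvd_mul_left d 2)
    simp [h0n, hdn, h2dn]

lemma normalForm_injective_of_tangent [CharZero F] {m : ℕ} (hm : 2 ≤ m) {μ μ' : F}
    (hh : IsTangentToId h) (H : comp h (normalForm m μ) = comp (normalForm m μ') h) : μ = μ' := by
  obtain ⟨d, rfl⟩ : ∃ d, m = d + 1 := ⟨m - 1, by omega⟩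
  have hsub : HasInitialTerm (normalForm (d + 1) μ - normalForm (d + 1) μ') (2 * d + 1)
      (μ - μ') := by
    convert hasInitialTerm_C_mul_X_pow (μ - μ') (2 * d + 1) using 1
    rw [normalForm_succ, normalForm_succ, map_sub]
    ring
  have := (hasLeadingTerm_normalForm hm μ).coeff_eq_of_comp_eq (hasLeadingTerm_normalForm hm μ')
    hsub.1 hh H
  rwa [← sub_eq_zero, ← map_sub, hsub.2, sub_eq_zero] at this

/-- The multiplier of the conjugacy is a `d`-th root of unity, and rescaling by such a root fixes
the normal forms, so the conjugacy may be taken tangent to the identity. -/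
lemma FormallyEquivalent.normalForm_injective [CharZero F] {m : ℕ} (hm : 2 ≤ m) {μ μ' : F}
    (H : FormallyEquivalent (normalForm m μ) (normalForm m μ')) : μ = μ' := by
  obtain ⟨d, rfl⟩ : ∃ d, m = d + 1 := ⟨m - 1, by omega⟩
  have hμ := hasLeadingTerm_normalForm hm μ
  have hμ' := hasLeadingTerm_normalForm hm μ'
  obtain ⟨h, hH⟩ := H
  obtain ⟨c, hc, hh, hcomp⟩ := (conjugates_iff hμ.1.1).1 hH
  have hcd : c ^ d = 1 := by
    have := (hμ.eq_of_comp_eq hμ' hh hc hcomp).2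
    rw [one_mul, mul_one, pow_succ] at this
    exact (right_eq_mul₀ hc).1 this
  have hH' := hH.trans hμ.1.1 hμ'.1.1 (conjugates_rescaling _ hc)
  rw [rescaling_normalForm hcd (by omega)] at hH'
  obtain ⟨-, -, -, hcomp'⟩ := (conjugates_iff hμ.1.1).1 hH'
  refine normalForm_injective_of_tangent hm (isTangentToId_iff.2 ?_) hcomp'
  rw [dilation_comp hh.coeff_zero, ← inv_mul_cancel₀ hc]
  simpa using (hasInitialTerm_C_mul_X_pow c⁻¹ 0).mul hh

lemma FormallyEquivalent.normalForm_unique [CharZero F] {m : ℕ} {μ μ' : F} (hm : 2 ≤ m)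
    (f0 : coeff 0 f = 0) (g0 : coeff 0 g = 0) (H : FormallyEquivalent f g)
    (hf : FormallyEquivalent f (normalForm m μ)) (hg : FormallyEquivalent g (normalForm m μ')) :
    μ = μ' :=
  have hμ0 := (hasLeadingTerm_normalForm hm μ).1.1
  normalForm_injective hm ((hf.symm f0).trans hμ0 f0 (H.trans f0 g0 hg))

end Rescaling

section Factorial

variable {F : Type*} [NormedField F]

lemma one_le_norm_natCast_of_forall_prime (h : ∀ p : ℕ, p.Prime → 1 ≤ ‖(p : F)‖) (n : ℕ) :
    n ≠ 0 → 1 ≤ ‖(n : F)‖ := by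
  induction n using Nat.recOnMul with
  | zero => exact fun h0 => absurd rfl h0
  | one => simp
  | prime p hp => exact fun _ => h p hp
  | mul m n ihm ihn =>
    intro hmn
    rw [Nat.cast_mul, norm_mul]
    exact one_le_mul_of_one_le_of_one_le (ihm (left_ne_zero_of_mul hmn))
      (ihn (right_ne_zero_of_mul hmn))

variable [IsUltrametricDist F]

lemma norm_natCast_eq_one_of_coprime {p n : ℕ} (hp : ‖(p : F)‖ < 1) (h : p.Coprime n) :
    ‖(n : F)‖ = 1 := by
  refine le_antisymm (IsUltrametricDist.norm_natCast_le_one F n) ?_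
  by_contra! hn
  obtain ⟨r, s, hrs⟩ := Nat.isCoprime_iff_coprime.2 h
  have hrs' : (r * p + s * n : F) = 1 := by exact_mod_cast congrArg (Int.cast (R := F)) hrs
  have hlt {x : F} (z : ℤ) (hx : ‖x‖ < 1) : ‖(z : F) * x‖ < 1 := by
    rw [norm_mul]
    exact (mul_le_of_le_one_left (norm_nonneg x)
      (IsUltrametricDist.norm_intCast_le_one F z)).trans_lt hx
  have := (IsUltrametricDist.norm_add_le_max (r * p : F) (s * n)).trans_lt
    (max_lt (hlt r hp) (hlt s hn))
  rw [hrs', norm_one] at this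
  exact lt_irrefl _ this

lemma norm_prime_pow_le_norm_factorial {p : ℕ} (hp : p.Prime) (hlt : ‖(p : F)‖ < 1) (n : ℕ) :
    ‖(p : F)‖ ^ n ≤ ‖(n.factorial : F)‖ := by
  have := Fact.mk hp
  have hle : n.factorial.factorization p ≤ n := by
    rw [Nat.factorization_def _ hp]
    exact padicValNat_factorial_le (p := p) n
  rw [← Nat.ordProj_mul_ordCompl_eq_self n.factorial p, Nat.cast_mul, norm_mul, Nat.cast_pow,
    norm_pow, norm_natCast_eq_one_of_coprime hlt (Nat.coprime_ordCompl hp n.factorial_ne_zero),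
    mul_one]
  exact pow_le_pow_of_le_one (norm_nonneg _) hlt.le hle

lemma exists_pow_le_norm_factorial (F : Type*) [NormedField F] [IsUltrametricDist F]
    [CharZero F] : ∃ c : ℝ, 0 < c ∧ c ≤ 1 ∧ ∀ n : ℕ, c ^ n ≤ ‖(n.factorial : F)‖ := by
  by_cases! hex : ∃ p : ℕ, p.Prime ∧ ‖(p : F)‖ < 1
  · obtain ⟨p, hp, hlt⟩ := hex
    exact ⟨‖(p : F)‖, norm_pos_iff.2 (Nat.cast_ne_zero.2 hp.ne_zero), hlt.le,
      norm_prime_pow_le_norm_factorial hp hlt⟩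
  · exact ⟨1, one_pos, le_rfl, fun n => by
      simpa using one_le_norm_natCast_of_forall_prime hex _ n.factorial_ne_zero⟩

end Factorial

section CoefficientBounds

/-- Submultiplicative weights on the degrees up to `M`. The truncation at `M` makes room for
weights that stop decreasing near the top degree. -/
structure IsWeight (W : ℕ → ℝ) (M : ℕ) : Prop where
  pos : ∀ n, 0 < W n
  zero_le_one : W 0 ≤ 1
  add_le_mul : ∀ i j, i + j ≤ M → W (i + j) ≤ W i * W j

lemma isWeight_one (M : ℕ) : IsWeight 1 M where
  pos _ := one_pos
  zero_le_one := le_rfl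
  add_le_mul _ _ _ := (mul_one _).ge

variable {F : Type*} [NormedField F]

/-- The coefficients of `f` in degrees up to `M` have weighted norm at most `1`. -/
def CoeffBound (W : ℕ → ℝ) (M : ℕ) (f : F⟦X⟧) : Prop :=
  ∀ n ≤ M, ‖coeff n f‖ * W n ≤ 1

variable {W : ℕ → ℝ} {M n k : ℕ} {f g φ q : F⟦X⟧}

lemma CoeffBound.X_mul (hW : Antitone W) (hq : CoeffBound W M q) : CoeffBound W M (X * q) := by
  rintro (_ | n) hn
  · simp
  · rw [coeff_succ_X_mul]
    exact (mul_le_mul_of_nonneg_left (hW n.le_succ) (norm_nonneg _)).trans (hq n (by omega))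

variable [IsUltrametricDist F]

lemma norm_sum_mul_le_one {ι : Type*} {s : Finset ι} {x : ι → F} {A : ℝ} (hA : 0 < A)
    (h : ∀ i ∈ s, ‖x i‖ * A ≤ 1) : ‖∑ i ∈ s, x i‖ * A ≤ 1 := by
  rw [← le_div_iff₀ hA]
  exact IsUltrametricDist.norm_sum_le_of_forall_le_of_nonneg (by positivity)
    fun i hi => (le_div_iff₀ hA).2 (h i hi)

lemma norm_sub_mul_le_one {x y : F} {A : ℝ} (hA : 0 < A) (hx : ‖x‖ * A ≤ 1)
    (hy : ‖y‖ * A ≤ 1) : ‖x - y‖ * A ≤ 1 :=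
  calc ‖x - y‖ * A ≤ max ‖x‖ ‖y‖ * A := by
        gcongr; simpa only [sub_eq_add_neg, norm_neg] using IsUltrametricDist.norm_add_le_max x (-y)
    _ = max (‖x‖ * A) (‖y‖ * A) := max_mul_of_nonneg _ _ hA.le
    _ ≤ 1 := max_le hx hy

namespace CoeffBound

lemma mul (hW : IsWeight W M) (hf : CoeffBound W M f) (hg : CoeffBound W M g) :
    CoeffBound W M (f * g) := by
  intro n hn
  rw [coeff_mul]
  refine norm_sum_mul_le_one (hW.pos n) fun ⟨i, j⟩ hij => ?_
  obtain rfl : i + j = n := Finset.HasAntidiagonal.mem_antidiagonal.1 hij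
  calc ‖coeff i f * coeff j g‖ * W (i + j)
      ≤ ‖coeff i f * coeff j g‖ * (W i * W j) := by gcongr; exact hW.add_le_mul i j hn
    _ = (‖coeff i f‖ * W i) * (‖coeff j g‖ * W j) := by rw [norm_mul, mul_mul_mul_comm]
    _ ≤ 1 := mul_le_one₀ (hf i (by omega)) (mul_nonneg (norm_nonneg _) (hW.pos j).le)
        (hg j (by omega))

lemma pow (hW : IsWeight W M) (hf : CoeffBound W M f) (k : ℕ) : CoeffBound W M (f ^ k) := by
  induction k with
  | zero =>
    intro n _
    rw [pow_zero, coeff_one]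
    split_ifs with hn
    · simpa [hn] using hW.zero_le_one
    · simp
  | succ k ih => rw [pow_succ]; exact mul hW ih hf

protected lemma comp (hW : IsWeight W M) {A : ℝ} (hA : 0 < A)
    (hφ : ∀ k, ‖coeff k φ‖ * A ≤ 1) (hf : CoeffBound W M f) (f0 : coeff 0 f = 0) :
    CoeffBound (fun n => A * W n) M (comp φ f) := by
  intro n hn
  rw [coeff_comp f0]
  refine norm_sum_mul_le_one (mul_pos hA (hW.pos n)) fun k _ => ?_
  rw [norm_mul, mul_mul_mul_comm]
  exact mul_le_one₀ (hφ k) (mul_nonneg (norm_nonneg _) (hW.pos n).le) (pow hW hf k n hn)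

end CoeffBound

lemma norm_coeff_comp_mul_le_one {A : ℝ} (hA : 0 < A) (hφ : ∀ k, ‖coeff k φ‖ * A ≤ 1)
    (hf : ∀ n, ‖coeff n f‖ ≤ 1) (f0 : coeff 0 f = 0) (n : ℕ) :
    ‖coeff n (comp φ f)‖ * A ≤ 1 := by
  simpa using CoeffBound.comp (isWeight_one n) hA hφ (fun k _ => by simpa using hf k) f0 n le_rfl

lemma norm_coeff_sub_X_le_one (hf : ∀ n, ‖coeff n f‖ ≤ 1) (n : ℕ) : ‖coeff n (f - X)‖ ≤ 1 := by
  have hX : ‖coeff n (X : F⟦X⟧)‖ ≤ 1 := by rw [coeff_X]; split_ifs <;> simp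
  simpa using norm_sub_mul_le_one one_pos (by simpa using hf n) (by simpa using hX)

lemma norm_coeff_add_comp_X_mul_mul_le_one (hW : IsWeight W n) (hanti : Antitone W)
    (hφX : X ^ k ∣ φ) (hφ : ∀ j, ‖coeff j φ‖ ≤ 1) (hq : CoeffBound W n q) :
    ‖coeff (n + k) (comp φ (X * q))‖ * W n ≤ 1 := by
  obtain ⟨γ, rfl⟩ := hφX
  have hγ (j : ℕ) : ‖coeff j γ‖ * 1 ≤ 1 := by simpa [coeff_X_pow_mul] using hφ (j + k)
  have hq0 : coeff 0 (X * q) = 0 := coeff_zero_X_mul q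
  have hcomp : CoeffBound W n (comp γ (X * q)) := by
    simpa using CoeffBound.comp hW one_pos hγ (hq.X_mul hanti) hq0
  rw [X_pow_mul_comp hq0, mul_pow, mul_assoc, coeff_X_pow_mul]
  exact CoeffBound.mul hW (CoeffBound.pow hW hq k) hcomp n le_rfl

end CoefficientBounds

section FactorialWeight

variable {F : Type*} [NormedField F] {a : F}

/-- The product of the norms of the factors `a, 2a, …, ka` by which the linearised conjugacy
equation divides. -/
noncomputable def factorialWeight (a : F) (k : ℕ) : ℝ :=
  ‖a ^ k * (k.factorial : F)‖

lemma factorialWeight_zero (a : F) : factorialWeight a 0 = 1 := by simp [factorialWeight]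

lemma factorialWeight_succ (a : F) (k : ℕ) :
    factorialWeight a (k + 1) = ‖(k + 1) * a‖ * factorialWeight a k := by
  rw [factorialWeight, factorialWeight, ← norm_mul, Nat.factorial_succ]
  push_cast
  ring_nf

lemma factorialWeight_pos [CharZero F] (ha : a ≠ 0) (k : ℕ) : 0 < factorialWeight a k :=
  norm_pos_iff.2 (mul_ne_zero (pow_ne_zero k ha) (Nat.cast_ne_zero.2 k.factorial_ne_zero))

variable [IsUltrametricDist F]

lemma factorialWeight_add_le_mul (a : F) (i j : ℕ) :
    factorialWeight a (i + j) ≤ factorialWeight a i * factorialWeight a j := by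
  obtain ⟨k, hk⟩ := Nat.factorial_mul_factorial_dvd_factorial_add i j
  have hsplit : a ^ (i + j) * ((i + j).factorial : F) =
      a ^ i * i.factorial * (a ^ j * j.factorial) * k := by
    rw [hk]; push_cast; ring
  rw [factorialWeight, hsplit, norm_mul, norm_mul]
  exact mul_le_of_le_one_right (by positivity) (IsUltrametricDist.norm_natCast_le_one F k)

lemma factorialWeight_antitone (ha : ‖a‖ ≤ 1) : Antitone (factorialWeight a) := by
  refine antitone_nat_of_succ_le fun k => ?_
  rw [factorialWeight_succ, norm_mul]
  refine mul_le_of_le_one_left (norm_nonneg _) (mul_le_one₀ ?_ (norm_nonneg a) ha)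
  exact_mod_cast IsUltrametricDist.norm_natCast_le_one F (k + 1)

lemma isWeight_factorialWeight_min [CharZero F] (ha : a ≠ 0) (ha1 : ‖a‖ ≤ 1) {d : ℕ} (hd : 1 ≤ d)
    (N : ℕ) : IsWeight (fun e => factorialWeight a (min (e - d) N)) (N + d + 1) where
  pos _ := factorialWeight_pos ha _
  zero_le_one := by simp [factorialWeight_zero]
  add_le_mul i j _ :=
    (factorialWeight_antitone ha1 (by omega)).trans (factorialWeight_add_le_mul a _ _)

end FactorialWeight

section GrowthOfConjugacies

variable {F : Type*} [NormedField F] [IsUltrametricDist F] [CharZero F] {f g h p : F⟦X⟧}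
  {d : ℕ} {a : F}

lemma HasLeadingTerm.norm_coeff_defect_mul_le_one (hf : HasLeadingTerm f (d + 1) a)
    (hg : HasLeadingTerm g (d + 1) a) (hfi : ∀ n, ‖coeff n f‖ ≤ 1) (hgi : ∀ n, ‖coeff n g‖ ≤ 1)
    {N : ℕ} (p0 : coeff 0 p = 0) (hpN : ∀ n, N + d + 1 < n → coeff n p = 0)
    (hp : ∀ n, ‖coeff n p‖ * factorialWeight a (n - (d + 1)) ≤ 1) :
    ‖coeff (N + d + 1 + (d + 1)) (defect f g p)‖ * factorialWeight a N ≤ 1 := by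
  obtain ⟨⟨f0, -⟩, hd, -, hfa, ha⟩ := hf
  have ha1 : ‖a‖ ≤ 1 := hfa ▸ hfi (d + 1)
  have hanti := factorialWeight_antitone ha1
  have hpos := factorialWeight_pos ha N
  have hp' (n : ℕ) : ‖coeff n p‖ * factorialWeight a N ≤ 1 := by
    rcases le_or_gt n (N + d + 1) with hn | hn
    · exact (mul_le_mul_of_nonneg_left (hanti (by omega)) (norm_nonneg _)).trans (hp n)
    · simp [hpN n hn]
  have hpf := norm_coeff_comp_mul_le_one hpos hp' hfi f0 (N + d + 1 + (d + 1))
  obtain ⟨q, rfl⟩ := X_dvd_iff.2 (by simpa using p0 : constantCoeff p = 0)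
  have hq : CoeffBound (fun e => factorialWeight a (min (e - d) N)) (N + d + 1) q := by
    intro e he
    rcases he.lt_or_eq with he | rfl
    · have := hp (e + 1)
      rwa [coeff_succ_X_mul, Nat.add_sub_add_right, ← min_eq_left (by omega : e - d ≤ N)] at this
    · rw [← coeff_succ_X_mul, hpN _ (Nat.lt_succ_self _), norm_zero, zero_mul]
      exact zero_le_one
  have hgp : ‖coeff (N + d + 1 + (d + 1)) (comp (g - X) (X * q))‖ * factorialWeight a N ≤ 1 := by
    simpa [min_eq_right (by omega : N ≤ N + d + 1 - d)] using
      norm_coeff_add_comp_X_mul_mul_le_one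
        (isWeight_factorialWeight_min ha ha1 (by omega) N)
        (fun i j hij => hanti (min_le_min_right N (Nat.sub_le_sub_right hij d)))
        (hasLeadingTerm_iff.1 hg).2.2.1 (norm_coeff_sub_X_le_one hgi) hq
  have hdefect : coeff (N + d + 1 + (d + 1)) (defect f g (X * q)) =
      coeff (N + d + 1 + (d + 1)) (comp (X * q) f) -
        coeff (N + d + 1 + (d + 1)) (comp (g - X) (X * q)) := by
    rw [comp_sub p0, X_comp p0, map_sub _ (comp g _), hpN _ (by omega), sub_zero, defect, map_sub]
  rw [hdefect]
  exact norm_sub_mul_le_one hpos hpf hgp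

lemma HasLeadingTerm.norm_coeff_mul_le_one (hf : HasLeadingTerm f (d + 1) a)
    (hg : HasLeadingTerm g (d + 1) a) (hfi : ∀ n, ‖coeff n f‖ ≤ 1) (hgi : ∀ n, ‖coeff n g‖ ≤ 1)
    (hh : IsTangentToId h) (hhi : ∀ n ≤ d + 1, ‖coeff n h‖ ≤ 1) (H : comp h f = comp g h) (n : ℕ) :
    ‖coeff n h‖ * factorialWeight a (n - (d + 1)) ≤ 1 := by
  induction n using Nat.strong_induction_on with
  | _ n ih =>
  rcases le_or_gt n (d + 1) with hn | hn
  · rw [Nat.sub_eq_zero_of_le hn, factorialWeight_zero, mul_one]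
    exact hhi n hn
  obtain ⟨N, rfl⟩ : ∃ N, n = N + d + 1 + 1 := ⟨n - (d + 2), by omega⟩
  set p : F⟦X⟧ := (trunc (N + d + 2) h : F⟦X⟧)
  have hp (n : ℕ) : coeff n p = if n < N + d + 2 then coeff n h else 0 := by
    rw [Polynomial.coeff_coe, coeff_trunc]
  have hp_tangent : IsTangentToId p := by
    simpa only [IsTangentToId, hp, if_pos (by omega : 0 < N + d + 2),
      if_pos (by omega : 1 < N + d + 2)] using hh
  have hp_bound (n : ℕ) : ‖coeff n p‖ * factorialWeight a (n - (d + 1)) ≤ 1 := by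
    rw [hp]
    split_ifs with hn
    · exact ih n hn
    · simp
  have hhp : HasInitialTerm (h - p) (N + d + 1 + 1) (coeff (N + d + 1 + 1) h) :=
    ⟨X_pow_dvd_iff.2 fun n hn => by rw [map_sub, hp, if_pos hn, sub_self],
      by rw [map_sub, hp, if_neg (lt_irrefl _), sub_zero]⟩
  have hrec : -coeff (N + d + 1 + (d + 1)) (defect f g p) =
      (N + 1) * a * coeff (N + d + 1 + 1) h := by
    have := (hf.defect_sub_defect hg hh hp_tangent hhp).2
    rw [defect_eq_zero_iff.2 H, zero_sub, map_neg] at this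
    rw [← add_assoc, this]
    push_cast
    ring
  calc ‖coeff (N + d + 1 + 1) h‖ * factorialWeight a (N + d + 1 + 1 - (d + 1))
      = ‖(N + 1) * a * coeff (N + d + 1 + 1) h‖ * factorialWeight a N := by
        rw [show N + d + 1 + 1 - (d + 1) = N + 1 by omega, factorialWeight_succ, norm_mul (_ * a)]
        ring
    _ = ‖coeff (N + d + 1 + (d + 1)) (defect f g p)‖ * factorialWeight a N := by
        rw [← hrec, norm_neg]
    _ ≤ 1 := hf.norm_coeff_defect_mul_le_one hg hfi hgi hp_tangent.1
        (fun n hn => by rw [hp, if_neg (by omega)]) hp_bound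

end GrowthOfConjugacies

section LocallyAnalytic

open scoped NNReal Topology

variable {F : Type*} [NormedField F] {f g h : F⟦X⟧}

lemma nnnorm_coeff_rpow_le_iff {n : ℕ} (hn : n ≠ 0) {R : ℝ≥0} :
    ‖coeff n f‖₊ ^ (1 / (n : ℝ)) ≤ R ↔ ‖coeff n f‖ ≤ R ^ n := by
  rw [one_div, NNReal.rpow_inv_le_iff (by positivity), NNReal.rpow_natCast, ← NNReal.coe_le_coe,
    coe_nnnorm, NNReal.coe_pow]

lemma enorm_coeff_rpow_le_iff {n : ℕ} (hn : n ≠ 0) {R : ℝ≥0} :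
    ‖coeff n f‖ₑ ^ (1 / (n : ℝ)) ≤ R ↔ ‖coeff n f‖ ≤ R ^ n := by
  rw [enorm_eq_nnnorm, ← ENNReal.coe_rpow_of_nonneg _ (by positivity), ENNReal.coe_le_coe,
    nnnorm_coeff_rpow_le_iff hn]

lemma locallyAnalytic_iff_eventually :
    LocallyAnalytic f ↔ ∃ R : ℝ≥0, ∀ᶠ n in atTop, ‖coeff n f‖ ≤ R ^ n := by
  rw [LocallyAnalytic, convergenceRadius, ENNReal.inv_pos]
  constructor
  · intro hf
    obtain ⟨R, hR, -⟩ := ENNReal.lt_iff_exists_nnreal_btwn.1 hf.lt_top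
    refine ⟨R, ?_⟩
    filter_upwards [eventually_lt_of_limsup_lt hR, eventually_ne_atTop 0] with n hnR hn
    exact (enorm_coeff_rpow_le_iff hn).1 hnR.le
  · rintro ⟨R, hR⟩
    refine ne_top_of_le_ne_top (ENNReal.coe_ne_top (r := R)) (limsup_le_of_le ?_ ?_)
    · isBoundedDefault
    filter_upwards [hR, eventually_ne_atTop 0] with n hnR hn
    exact (enorm_coeff_rpow_le_iff hn).2 hnR

lemma LocallyAnalytic.exists_forall_norm_coeff_le (hf : LocallyAnalytic f) :
    ∃ R : ℝ≥0, ∀ n ≠ 0, ‖coeff n f‖ ≤ R ^ n := by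
  obtain ⟨R, hR⟩ := locallyAnalytic_iff_eventually.1 hf
  have hbdd : IsBoundedUnder (· ≤ ·) atTop fun n : ℕ => ‖coeff n f‖₊ ^ (1 / (n : ℝ)) := by
    refine ⟨R, eventually_map.2 ?_⟩
    filter_upwards [hR, eventually_ne_atTop 0] with n hnR hn
    exact (nnnorm_coeff_rpow_le_iff hn).2 hnR
  obtain ⟨S, hS⟩ := hbdd.bddAbove_range
  exact ⟨S, fun n hn => (nnnorm_coeff_rpow_le_iff hn).1 (hS ⟨n, rfl⟩)⟩

lemma LocallyAnalytic.of_norm_coeff_le {E : Type*} [NormedField E] {g : E⟦X⟧}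
    (hf : LocallyAnalytic f) (A : ℝ≥0) (h : ∀ n ≠ 0, ‖coeff n g‖ ≤ A ^ n * ‖coeff n f‖) :
    LocallyAnalytic g := by
  obtain ⟨R, hR⟩ := locallyAnalytic_iff_eventually.1 hf
  refine locallyAnalytic_iff_eventually.2 ⟨A * R, ?_⟩
  filter_upwards [hR, eventually_ne_atTop 0] with n hnR hn
  rw [NNReal.coe_mul, mul_pow]
  exact (h n hn).trans (by gcongr)

lemma LocallyAnalytic.map {L : Type*} [NormedField L] [NormedAlgebra F L]
    (hf : LocallyAnalytic f) : LocallyAnalytic (PowerSeries.map (algebraMap F L) f) :=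
  hf.of_norm_coeff_le 1 fun n _ => by simp [norm_algebraMap']

lemma LocallyAnalytic.C_mul (hf : LocallyAnalytic f) (c : F) : LocallyAnalytic (C c * f) := by
  refine hf.of_norm_coeff_le (max 1 ‖c‖₊) fun n hn => ?_
  rw [coeff_C_mul, norm_mul]
  gcongr
  exact_mod_cast (le_max_right 1 ‖c‖₊).trans (le_self_pow₀ (le_max_left 1 ‖c‖₊) hn)

lemma LocallyAnalytic.comp_dilation (hf : LocallyAnalytic f) (t : F) :
    LocallyAnalytic (comp f (dilation t)) :=
  hf.of_norm_coeff_le ‖t‖₊ fun n _ => by rw [coeff_comp_dilation, norm_mul, norm_pow, coe_nnnorm]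

protected lemma LocallyAnalytic.rescaling (hf : LocallyAnalytic f) (f0 : coeff 0 f = 0) (t : F) :
    LocallyAnalytic (rescaling t f) := by
  have ft0 : coeff 0 (comp f (dilation t)) = 0 := by rw [coeff_comp_dilation, f0, mul_zero]
  rw [TangentToIdentity.rescaling, dilation_comp ft0]
  exact (hf.comp_dilation t).C_mul t⁻¹

lemma locallyAnalytic_coe (p : Polynomial F) : LocallyAnalytic (p : F⟦X⟧) := by
  refine locallyAnalytic_iff_eventually.2 ⟨0, ?_⟩
  filter_upwards [eventually_gt_atTop p.natDegree] with n hn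
  rw [Polynomial.coeff_coe, Polynomial.coeff_eq_zero_of_natDegree_lt hn, norm_zero]
  positivity

lemma locallyAnalytic_dilation (c : F) : LocallyAnalytic (dilation c) := by
  have := locallyAnalytic_coe (Polynomial.C c * Polynomial.X)
  rwa [Polynomial.coe_mul, Polynomial.coe_C, Polynomial.coe_X] at this

lemma locallyAnalytic_normalForm (m : ℕ) (μ : F) : LocallyAnalytic (normalForm m μ) := by
  have := locallyAnalytic_coe
    (Polynomial.X + Polynomial.X ^ m + Polynomial.C μ * Polynomial.X ^ (2 * m - 1))
  simpa only [Polynomial.coe_add, Polynomial.coe_mul, Polynomial.coe_pow, Polynomial.coe_C,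
    Polynomial.coe_X, normalForm] using this

lemma locallyAnalytic_of_punctured_nhds_eq_bot (hF : 𝓝[≠] (0 : F) = ⊥) (f : F⟦X⟧) :
    LocallyAnalytic f := by
  have := discreteTopology_of_isOpen_singleton_zero (isOpen_singleton_iff_punctured_nhds 0 |>.2 hF)
  exact locallyAnalytic_iff_eventually.2
    ⟨1, .of_forall fun n => by simp⟩

lemma LocallyAnalytic.eventually_norm_coeff_rescaling_le_one (hf : LocallyAnalytic f)
    (hft : IsTangentToId f) : ∀ᶠ t in 𝓝[≠] (0 : F), ∀ n, ‖coeff n (rescaling t f)‖ ≤ 1 := by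
  obtain ⟨R, hR⟩ := hf.exists_forall_norm_coeff_le
  have hsmall (B : ℝ) : ∀ᶠ t in 𝓝[≠] (0 : F), ‖t‖ * B ≤ 1 := by
    have : Tendsto (fun t : F => ‖t‖ * B) (𝓝[≠] 0) (𝓝 0) :=
      ((by fun_prop : Continuous fun t : F => ‖t‖ * B).tendsto' 0 0 (by simp)).mono_left
        nhdsWithin_le_nhds
    exact this.eventually_le_const one_pos
  filter_upwards [hsmall R, hsmall (R ^ 2), self_mem_nhdsWithin] with t h1 h2 ht n
  match n with
  | 0 => simp [coeff_zero_rescaling hft.1]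
  | 1 => simp [(hft.rescaling ht).2]
  | n + 2 =>
    rw [coeff_succ_rescaling hft.1 ht, norm_mul, norm_pow]
    calc ‖t‖ ^ (n + 1) * ‖coeff (n + 2) f‖ ≤ ‖t‖ ^ (n + 1) * R ^ (n + 2) := by
          gcongr; exact hR _ (by omega)
      _ = (‖t‖ * R) ^ n * (‖t‖ * R ^ 2) := by ring
      _ ≤ 1 := mul_le_one₀ (pow_le_one₀ (by positivity) h1) (by positivity) h2

lemma eventually_norm_coeff_rescaling_le_one (hh : IsTangentToId h) (N : ℕ) :
    ∀ᶠ t in 𝓝[≠] (0 : F), ∀ n ≤ N, ‖coeff n (rescaling t h)‖ ≤ 1 := by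
  have hcoeff (n : ℕ) (hn : n < N + 2) : coeff n (trunc (N + 2) h : F⟦X⟧) = coeff n h := by
    rw [Polynomial.coeff_coe, coeff_trunc, if_pos hn]
  have ht : IsTangentToId (trunc (N + 2) h : F⟦X⟧) :=
    ⟨(hcoeff 0 (by omega)).trans hh.1, (hcoeff 1 (by omega)).trans hh.2⟩
  filter_upwards [(locallyAnalytic_coe _).eventually_norm_coeff_rescaling_le_one ht,
    self_mem_nhdsWithin] with t hbound ht0 n hn
  rcases n with _ | n
  · simp [coeff_zero_rescaling hh.1]
  · have := hbound (n + 1)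
    rwa [coeff_succ_rescaling ht.1 ht0, hcoeff _ (by omega), ← coeff_succ_rescaling hh.1 ht0]
      at this

end LocallyAnalytic

section ConvergenceOfConjugacies

open scoped NNReal Topology

variable {F : Type*} [NormedField F] [IsUltrametricDist F] [CharZero F] {f g h : F⟦X⟧}

lemma locallyAnalytic_of_norm_coeff_mul_factorialWeight_le {a : F} (ha : a ≠ 0) (ha1 : ‖a‖ ≤ 1)
    (m : ℕ) (H : ∀ n, ‖coeff n h‖ * factorialWeight a (n - m) ≤ 1) : LocallyAnalytic h := by
  obtain ⟨c, hc, hc1, hfac⟩ := exists_pow_le_norm_factorial F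
  have hac : 0 < ‖a‖ * c := mul_pos (norm_pos_iff.2 ha) hc
  have hweight (n : ℕ) : (‖a‖ * c) ^ n ≤ factorialWeight a (n - m) :=
    calc (‖a‖ * c) ^ n ≤ (‖a‖ * c) ^ (n - m) :=
          pow_le_pow_of_le_one hac.le (mul_le_one₀ ha1 hc.le hc1) (Nat.sub_le n m)
      _ ≤ factorialWeight a (n - m) := by
          rw [factorialWeight, norm_mul, norm_pow, mul_pow]
          gcongr
          exact hfac _
  refine locallyAnalytic_iff_eventually.2 ⟨(‖a‖₊ * c.toNNReal)⁻¹, .of_forall fun n => ?_⟩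
  rw [NNReal.coe_inv, NNReal.coe_mul, coe_nnnorm, Real.coe_toNNReal c hc.le, inv_pow, ← one_div,
    le_div_iff₀ (by positivity)]
  exact (mul_le_mul_of_nonneg_left (hweight n) (norm_nonneg _)).trans (H n)

lemma HasLeadingTerm.locallyAnalytic_of_comp_eq {m : ℕ} {a : F} (hf : LocallyAnalytic f)
    (hg : LocallyAnalytic g) (hfm : HasLeadingTerm f m a) (hgm : HasLeadingTerm g m a)
    (hh : IsTangentToId h) (H : comp h f = comp g h) : LocallyAnalytic h := by
  rcases eq_or_neBot (𝓝[≠] (0 : F)) with hF | hF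
  · exact locallyAnalytic_of_punctured_nhds_eq_bot hF h
  obtain ⟨d, rfl⟩ : ∃ d, m = d + 1 := ⟨m - 1, by have := hfm.2.1; omega⟩
  obtain ⟨t, hft, hgt, hht, ht⟩ := ((hf.eventually_norm_coeff_rescaling_le_one hfm.1).and <|
    (hg.eventually_norm_coeff_rescaling_le_one hgm.1).and <|
    (eventually_norm_coeff_rescaling_le_one hh (d + 1)).and self_mem_nhdsWithin).exists
  have hfm' := hfm.rescaling ht
  have hbound := hfm'.norm_coeff_mul_le_one (hgm.rescaling ht) hft hgt (hh.rescaling ht) hht <| by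
    rw [rescaling_comp_rescaling hh.1 hfm.1.1 ht, H, rescaling_comp_rescaling hgm.1.1 hh.1 ht]
  obtain ⟨-, -, -, hcoeff, ha⟩ := hfm'
  have hLA := locallyAnalytic_of_norm_coeff_mul_factorialWeight_le ha (hcoeff ▸ hft (d + 1))
    (d + 1) hbound
  rw [← rescaling_inv_rescaling hh.1 ht]
  exact hLA.rescaling (coeff_zero_rescaling hh.1 t) t⁻¹

/-- Formal conjugacies converge as soon as `f ≠ X`; every series fixing the origin commutes
with `X`. -/
theorem Conjugates.locallyAnalytic (hf : LocallyAnalytic f) (hg : LocallyAnalytic g)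
    (hft : IsTangentToId f) (hgt : IsTangentToId g) (hfX : f ≠ X) (H : Conjugates h f g) :
    LocallyAnalytic h := by
  obtain ⟨m, a, hfm⟩ := hft.exists_hasLeadingTerm hfX
  obtain ⟨m', a', hgm⟩ := hgt.exists_hasLeadingTerm (mt (H.eq_X_iff hft.1).2 hfX)
  obtain ⟨c, hc, hh, hcomp⟩ := (conjugates_iff hft.1).1 H
  obtain ⟨rfl, ha⟩ := hfm.eq_of_comp_eq hgm hh hc hcomp
  obtain ⟨d, rfl⟩ : ∃ d, m = d + 1 := ⟨m - 1, by have := hfm.2.1; omega⟩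
  have hgm' : HasLeadingTerm (rescaling c g) (d + 1) a := by
    convert hgm.rescaling hc using 1
    exact mul_right_cancel₀ hc (by rw [ha]; ring)
  have hconj := H.trans hft.1 hgt.1 (conjugates_rescaling g hc)
  rw [dilation_comp hh.coeff_zero] at hconj
  obtain ⟨-, -, -, hcomp'⟩ := (conjugates_iff hft.1).1 hconj
  have hh' : IsTangentToId (C c⁻¹ * h) := by
    rw [isTangentToId_iff, ← inv_mul_cancel₀ hc]
    simpa using (hasInitialTerm_C_mul_X_pow c⁻¹ 0).mul hh
  have := (hfm.locallyAnalytic_of_comp_eq hf (hg.rescaling hgt.1 c) hgm' hh' hcomp').C_mul c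
  rwa [← mul_assoc, ← map_mul, mul_inv_cancel₀ hc, map_one, one_mul] at this

theorem HasLeadingTerm.exists_conjugates_normalForm {m : ℕ} {a α : F}
    (hfm : HasLeadingTerm f m a) (hf : LocallyAnalytic f) (hα : α ^ (m - 1) = a) :
    ∃ (μ : F) (h : F⟦X⟧), LocallyAnalytic h ∧ IsTangentToId h ∧
      Conjugates (comp h (dilation α)) f (normalForm m μ) := by
  obtain ⟨d, rfl⟩ : ∃ d, m = d + 1 := ⟨m - 1, by have := hfm.2.1; omega⟩
  rw [Nat.add_sub_cancel] at hα
  have hα0 : α ≠ 0 := by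
    rintro rfl
    exact hfm.2.2.2.2 (hα ▸ zero_pow (by have := hfm.2.1; omega))
  have hfm' : HasLeadingTerm (rescaling α⁻¹ f) (d + 1) 1 := by
    convert hfm.rescaling (inv_ne_zero hα0) using 1
    rw [← hα, ← mul_pow, inv_mul_cancel₀ hα0, one_pow]
  obtain ⟨μ, h, hh, H⟩ := exists_comp_eq_normalForm hfm'
  have hLA : LocallyAnalytic h := hfm'.locallyAnalytic_of_comp_eq (hf.rescaling hfm.1.1 α⁻¹)
    (locallyAnalytic_normalForm _ μ) (hasLeadingTerm_normalForm hfm.2.1 μ) hh H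
  have hdilation : Conjugates (dilation α) f (rescaling α⁻¹ f) := by
    simpa using conjugates_rescaling f (inv_ne_zero hα0)
  exact ⟨μ, h, hLA, hh, hdilation.trans hfm.1.1 hfm'.1.1
    ((conjugates_iff hfm'.1.1).2 ⟨1, one_ne_zero, hasInitialTerm_one_iff.2 hh, H⟩)⟩

theorem exists_conjugates_iff_exists_locallyAnalytic (hf : LocallyAnalytic f)
    (hg : LocallyAnalytic g) (hft : IsTangentToId f) (hgt : IsTangentToId g) (c : F) :
    (∃ h, coeff 1 h = c ∧ Conjugates h f g) ↔
      ∃ h, LocallyAnalytic h ∧ coeff 1 h = c ∧ Conjugates h f g := by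
  refine ⟨fun ⟨h, hc, H⟩ => ?_, fun ⟨h, _, hc, H⟩ => ⟨h, hc, H⟩⟩
  rcases eq_or_ne f X with rfl | hfX
  · obtain rfl : g = X := (H.eq_X_iff hft.1).1 rfl
    obtain ⟨c', hc', hh, -⟩ := (conjugates_iff hft.1).1 H
    obtain rfl : c' = c := hh.2.symm.trans hc
    have hD := conjugates_rescaling X (inv_ne_zero hc')
    exact ⟨dilation c', locallyAnalytic_dilation c', by simp [dilation], by
      simpa [rescaling, X_comp, coeff_zero_dilation, dilation_comp_dilation, hc', dilation_one]
        using hD⟩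
  · exact ⟨h, H.locallyAnalytic hf hg hft hgt hfX, hc, H⟩

end ConvergenceOfConjugacies

end TangentToIdentity

theorem theorem1p1_general (K : Type u) [NormedField K] [IsUltrametricDist K] [CharZero K] :
    (∀ (f : K⟦X⟧) (m : ℕ) (a : K), TangentToIdentity.LocallyAnalytic f →
      TangentToIdentity.HasLeadingTerm f m a →
      ∀ (L : Type v) [NormedField L] [NormedAlgebra K L] (α : L),
        α ^ (m - 1) = algebraMap K L a →
        ∃ (μ : L) (h : L⟦X⟧), TangentToIdentity.LocallyAnalytic h ∧
          TangentToIdentity.IsTangentToId h ∧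
          TangentToIdentity.Conjugates
            (TangentToIdentity.comp h (TangentToIdentity.dilation α))
            (PowerSeries.map (algebraMap K L) f)
            (TangentToIdentity.normalForm m μ)) ∧
    (∀ (f g : K⟦X⟧) (m m' : ℕ) (a a' : K),
      TangentToIdentity.HasLeadingTerm f m a → TangentToIdentity.HasLeadingTerm g m' a' →
      ∀ (L : Type v) [Field L] [Algebra K L],
        TangentToIdentity.FormallyEquivalent
          (PowerSeries.map (algebraMap K L) f) (PowerSeries.map (algebraMap K L) g) →
        m = m' ∧
        ∀ μ μ' : L,
          TangentToIdentity.FormallyEquivalent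
            (PowerSeries.map (algebraMap K L) f) (TangentToIdentity.normalForm m μ) →
          TangentToIdentity.FormallyEquivalent
            (PowerSeries.map (algebraMap K L) g) (TangentToIdentity.normalForm m' μ') →
          μ = μ') ∧
    (∀ f g : K⟦X⟧, TangentToIdentity.LocallyAnalytic f → TangentToIdentity.LocallyAnalytic g →
      TangentToIdentity.IsTangentToId f → TangentToIdentity.IsTangentToId g →
      ∀ c : K,
        (∃ h : K⟦X⟧, PowerSeries.coeff 1 h = c ∧ TangentToIdentity.Conjugates h f g) ↔
        (∃ h : K⟦X⟧, TangentToIdentity.LocallyAnalytic h ∧ PowerSeries.coeff 1 h = c ∧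
          TangentToIdentity.Conjugates h f g)) := by
  refine ⟨fun f m a hf hfm L _ _ α hα => ?_, fun f g m m' a a' hfm hgm L _ _ H => ?_,
    fun f g hf hg hft hgt c =>
      TangentToIdentity.exists_conjugates_iff_exists_locallyAnalytic hf hg hft hgt c⟩
  · have : CharZero L := charZero_of_injective_algebraMap (algebraMap K L).injective
    have : IsUltrametricDist L :=
      IsUltrametricDist.isUltrametricDist_of_forall_norm_natCast_le_one fun n => by
        rw [← map_natCast (algebraMap K L), norm_algebraMap']
        exact IsUltrametricDist.norm_natCast_le_one K n
    exact (hfm.map (algebraMap K L)).exists_conjugates_normalForm hf.map hα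
  · have : CharZero L := charZero_of_injective_algebraMap (algebraMap K L).injective
    have hfm' := hfm.map (algebraMap K L)
    have hgm' := hgm.map (algebraMap K L)
    obtain rfl := H.order_eq hfm' hgm'
    exact ⟨rfl, fun μ μ' hf hg => H.normalForm_unique hfm.2.1 hfm'.1.1 hgm'.1.1 hf hg⟩

theorem theorem1p1 (K : Type u) [NontriviallyNormedField K] [IsUltrametricDist K]
    [CompleteSpace K] [CharZero K] :
    -- Reduction to the normal form over `L = K(α)`, for each root `α` of `α ^ (m - 1) = a`.
    (∀ (f : K⟦X⟧) (m : ℕ) (a : K), TangentToIdentity.LocallyAnalytic f →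
      TangentToIdentity.HasLeadingTerm f m a →
      ∀ (L : Type v) [NormedField L] [NormedAlgebra K L] (α : L),
        α ^ (m - 1) = algebraMap K L a → K⟮α⟯ = ⊤ →
        ∃ (μ : L) (h : L⟦X⟧), TangentToIdentity.LocallyAnalytic h ∧
          TangentToIdentity.IsTangentToId h ∧
          TangentToIdentity.Conjugates
            (TangentToIdentity.comp h (TangentToIdentity.dilation α))
            (PowerSeries.map (algebraMap K L) f)
            (TangentToIdentity.normalForm m μ)) ∧
    -- `m` and `μ` are analytic invariants.
    (∀ (f g : K⟦X⟧) (m m' : ℕ) (a a' : K), TangentToIdentity.LocallyAnalytic f →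
      TangentToIdentity.LocallyAnalytic g →
      TangentToIdentity.HasLeadingTerm f m a → TangentToIdentity.HasLeadingTerm g m' a' →
      ∀ (L : Type v) [NormedField L] [NormedAlgebra K L],
        TangentToIdentity.AnalyticallyEquivalent
          (PowerSeries.map (algebraMap K L) f) (PowerSeries.map (algebraMap K L) g) →
        m = m' ∧
        ∀ μ μ' : L,
          TangentToIdentity.AnalyticallyEquivalent
            (PowerSeries.map (algebraMap K L) f) (TangentToIdentity.normalForm m μ) →
          TangentToIdentity.AnalyticallyEquivalent
            (PowerSeries.map (algebraMap K L) g) (TangentToIdentity.normalForm m' μ') →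
          μ = μ') ∧
    -- The formal and the analytic classifications coincide, for each multiplier `c` of the
    -- conjugating series (`c = 1` being conjugation by series tangent to the identity).
    (∀ f g : K⟦X⟧, TangentToIdentity.LocallyAnalytic f → TangentToIdentity.LocallyAnalytic g →
      TangentToIdentity.IsTangentToId f → TangentToIdentity.IsTangentToId g →
      ∀ c : K,
        (∃ h : K⟦X⟧, PowerSeries.coeff 1 h = c ∧ TangentToIdentity.Conjugates h f g) ↔
        (∃ h : K⟦X⟧, TangentToIdentity.LocallyAnalytic h ∧ PowerSeries.coeff 1 h = c ∧
          TangentToIdentity.Conjugates h f g)) :=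
  let ⟨normal_form, invariants, classification⟩ := theorem1p1_general K
  ⟨fun f m a hf hfm L _ _ α hα _ => normal_form f m a hf hfm L α hα,
    fun f g m m' a a' _ _ hfm hgm L _ _ H =>
      (invariants f g m m' a a' hfm hgm L H.formallyEquivalent).imp_right fun hμ μ μ' Hf Hg =>
        hμ μ μ' Hf.formallyEquivalent Hg.formallyEquivalent,
    classification⟩
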